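/- Let $K$ be a field and $n\ge 2$ an integer. On the space $M_n(K)$ of $n\times n$ matrices over $K$, when $\operatorname{char}K\neq 2$, consider the Jordan product $A\circ B=\tfrac12(AB+BA)$, and write $M_n(K)^+$ for the resulting special Jordan algebra. For $A\in M_n(K)$ let $L_A\colon M_n(K)\to M_n(K)$, $L_A(X)=A\circ X$, and let $$\mathrm{JMS}(M_n(K)^+)=\langle L_A : A\in M_n(K)\rangle\subseteq \mathrm{End}_K(M_n(K))$$ be the subsemigroup, under composition, generated by all the operators $L_A$. Let $\mathrm{GL}(M_n(K))$ be the group of invertible $K$-linear endomorphisms of the vector space $M_n(K)$. (a) If $K$ is infinite and $\operatorname{char}K\neq 2$, then $$\mathrm{GL}(M_n(K))\subseteq \mathrm{JMS}(M_n(K)^+)\quad\text{and}\quad \mathrm{JMS}(M_n(K)^+)=\mathrm{End}_K(M_n(K)).$$ (b) If $K$ is finite of odd characteristic, then likewise $$\mathrm{GL}(M_n(K))\subseteq \mathrm{JMS}(M_n(K)^+)\quad\text{and}\quad \mathrm{JMS}(M_n(K)^+)=\mathrm{End}_K(M_n(K)).$$ -/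

import Mathlib

/-- The Jordan product `A ∘ B = (1/2)(AB + BA)` of the special Jordan algebra `M_n(K)⁺`. -/
def jordanMul {K : Type*} [Field K] {n : ℕ} (A B : Matrix (Fin n) (Fin n) K) :
    Matrix (Fin n) (Fin n) K :=
  (2 : K)⁻¹ • (A * B + B * A)

/-- When `2` is invertible, `jordanMul` is the product of Mathlib's symmetrized algebra. -/
theorem jordanMul_eq_symAlg {K : Type*} [Field K] {n : ℕ} (h2 : (2 : K) ≠ 0)
    [Invertible (2 : Matrix (Fin n) (Fin n) K)] (A B : Matrix (Fin n) (Fin n) K) :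
    jordanMul A B = SymAlg.unsym (SymAlg.sym A * SymAlg.sym B) := by
  have h : (2 : Matrix (Fin n) (Fin n) K) * jordanMul A B = A * B + B * A := by
    rw [jordanMul, two_mul, ← two_smul K, smul_smul, mul_inv_cancel₀ h2, one_smul]
  rw [SymAlg.unsym_mul, SymAlg.unsym_sym, SymAlg.unsym_sym, ← h, invOf_mul_cancel_left]

/-- The multiplication operator `L_A : X ↦ A ∘ X`, a `K`-linear endomorphism of `M_n(K)`. -/
def jordanL {K : Type*} [Field K] {n : ℕ} (A : Matrix (Fin n) (Fin n) K) :
    Module.End K (Matrix (Fin n) (Fin n) K) where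
  toFun X := jordanMul A X
  map_add' X Y := by
    simp only [jordanMul, mul_add, add_mul, ← smul_add]
    congr 1
    abel
  map_smul' c X := by
    simp only [jordanMul, Matrix.mul_smul, Matrix.smul_mul, ← smul_add, RingHom.id_apply]
    rw [smul_comm]

/-- The Jordan multiplication semigroup `JMS(M_n(K)⁺)`: the subsemigroup of `End_K(M_n(K))`
(under composition) generated by all the operators `L_A`. -/
def JMS (K : Type*) [Field K] (n : ℕ) :
    Subsemigroup (Module.End K (Matrix (Fin n) (Fin n) K)) :=
  Subsemigroup.closure (Set.range (jordanL (K := K) (n := n)))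

/-! ### Operators `X ↦ X + c N X N` with `N² = 0`. -/

section Sandwich

variable {K : Type*} [Field K] {n : ℕ}

/-! In the standard basis, operators on `M_n(K)` become matrices of size `n²`. The semigroup is
shown to contain generators of all of these: transvections, an invertible operator of each nonzero
determinant, and diagonal idempotents of corank one.

For suitable `N` with `N² = 0`, products of operators `L_A` give `X ↦ X + c N X N`. Composing these
with maps `X ↦ x X x` makes the left and right factors differ (`rankOne_mem_jmsMatrices`).
Polarisation in a parameter and commutators then isolate every transvection
(`transvection_mem_jmsMatrices`), hence determinant one. A single `L_A` attains any nonzero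
determinant (`exists_det_jordanL_eq`), which gives the general linear group. Finally, `L_A` for `A`
a diagonal idempotent of corank one kills a single matrix unit, and elimination yields all
operators. -/

theorem jordanL_apply (A X : Matrix (Fin n) (Fin n) K) :
    jordanL A X = (2 : K)⁻¹ • (A * X + X * A) := rfl

theorem jordanL_mem_JMS (A : Matrix (Fin n) (Fin n) K) : jordanL A ∈ JMS K n :=
  Subsemigroup.subset_closure ⟨A, rfl⟩

theorem jordanL_smul_one (h2 : (2 : K) ≠ 0) (c : K) :
    jordanL (c • (1 : Matrix (Fin n) (Fin n) K)) = c • 1 := by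
  ext1 X
  simp only [jordanL_apply, smul_mul_assoc, one_mul, mul_smul_comm, mul_one,
    LinearMap.smul_apply, Module.End.one_apply]
  match_scalars
  field_simp
  ring

theorem one_mem_JMS (h2 : (2 : K) ≠ 0) : 1 ∈ JMS K n := by
  have := jordanL_mem_JMS ((1 : K) • (1 : Matrix (Fin n) (Fin n) K))
  rwa [jordanL_smul_one h2, one_smul] at this

theorem smul_mem_JMS (h2 : (2 : K) ≠ 0) (c : K)
    {g : Module.End K (Matrix (Fin n) (Fin n) K)} (hg : g ∈ JMS K n) : c • g ∈ JMS K n := by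
  have := mul_mem (jordanL_mem_JMS (c • (1 : Matrix (Fin n) (Fin n) K))) hg
  rwa [jordanL_smul_one h2, smul_mul_assoc, one_mul] at this

/-- The operator `X ↦ X + c N X N`. -/
def sandwich (N : Matrix (Fin n) (Fin n) K) (c : K) :
    Module.End K (Matrix (Fin n) (Fin n) K) :=
  1 + c • (LinearMap.mulLeft K N * LinearMap.mulRight K N)

theorem sandwich_apply (N : Matrix (Fin n) (Fin n) K) (c : K) (X : Matrix (Fin n) (Fin n) K) :
    sandwich N c X = X + c • (N * X * N) := by
  simp [sandwich, mul_assoc]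

theorem sandwich_mul_sandwich {N : Matrix (Fin n) (Fin n) K} (hN : N * N = 0) (c d : K) :
    sandwich N c * sandwich N d = sandwich N (c + d) := by
  ext1 X
  have h (Y : Matrix (Fin n) (Fin n) K) : N * (N * Y) = 0 := by rw [← mul_assoc, hN, zero_mul]
  simp only [Module.End.mul_apply, sandwich_apply, mul_add, mul_smul_comm,
    mul_assoc, h, smul_zero, add_zero]
  module

theorem sandwich_smul (N : Matrix (Fin n) (Fin n) K) (t c : K) :
    sandwich (t • N) c = sandwich N (c * t ^ 2) := by
  ext1 X
  simp only [sandwich_apply, smul_mul_assoc, mul_smul_comm]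
  module

/-- `L_{1+N} L_{1-N} = 1 - L_N²`, and `L_N² X = N X N / 2` because `N² = 0`. -/
theorem sandwich_neg_half_mem_JMS (h2 : (2 : K) ≠ 0) {N : Matrix (Fin n) (Fin n) K}
    (hN : N * N = 0) (t : K) : sandwich N (-2⁻¹ * t ^ 2) ∈ JMS K n := by
  have key (N : Matrix (Fin n) (Fin n) K) (hN : N * N = 0) : sandwich N (-2⁻¹) ∈ JMS K n := by
    convert mul_mem (jordanL_mem_JMS (1 + N)) (jordanL_mem_JMS (1 - N)) using 1
    ext1 X
    have h (Y : Matrix (Fin n) (Fin n) K) : N * (N * Y) = 0 := by rw [← mul_assoc, hN, zero_mul]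
    simp only [Module.End.mul_apply, sandwich_apply, jordanL_apply, mul_add, add_mul, mul_sub,
      sub_mul, mul_smul_comm, smul_mul_assoc, mul_assoc, hN, h, mul_zero, one_mul, mul_one]
    match_scalars <;> field_simp <;> norm_num
  rw [← sandwich_smul]
  exact key _ (by simp [hN])

/-- `L_M` has eigenvalues among `s = 0, ±1`. Since `(3/5)² + (4/5)² = 1`, the product `(9/25 -
s²)(16/25 - s²)` equals `144/625` at all three, so the inverse `W` of `L_{3/5+M}` is again a product
of generators. With `T = L_N W`, the factors `L_{3/5+M±N} W` are `1 ± T`, and their product `1 - T²`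
has a coefficient of the missing sign. -/
theorem sandwich_mem_JMS_of_charZero [CharZero K] {M N : Matrix (Fin n) (Fin n) K}
    (hM : M * M = 1) (hMN : M * N = N) (hNM : N * M = -N) (hN : N * N = 0) :
    sandwich N (25 / 32) ∈ JMS K n := by
  have h2 : (2 : K) ≠ 0 := two_ne_zero
  have hM' (Y : Matrix (Fin n) (Fin n) K) : M * (M * Y) = Y := by rw [← mul_assoc, hM, one_mul]
  have hN' (Y : Matrix (Fin n) (Fin n) K) : N * (N * Y) = 0 := by rw [← mul_assoc, hN, zero_mul]
  have hMN' (Y : Matrix (Fin n) (Fin n) K) : M * (N * Y) = N * Y := by rw [← mul_assoc, hMN]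
  have hNM' (Y : Matrix (Fin n) (Fin n) K) : N * (M * Y) = -(N * Y) := by
    rw [← mul_assoc, hNM, neg_mul]
  set W := (625 / 144 : K) • (jordanL ((3 / 5 : K) • 1 - M) *
    (jordanL ((4 / 5 : K) • 1 + M) * jordanL ((4 / 5 : K) • 1 - M))) with hW
  have hWmem : W ∈ JMS K n := smul_mem_JMS h2 _
    (mul_mem (jordanL_mem_JMS _) (mul_mem (jordanL_mem_JMS _) (jordanL_mem_JMS _)))
  have hWX (X : Matrix (Fin n) (Fin n) K) : W X = (7 / 50 * (125 / 48) : K) • X +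
      (3 / 10 * (125 / 48) : K) • (M * X + X * M) - (1 / 2 * (125 / 48) : K) • (M * X * M) := by
    simp only [hW, LinearMap.smul_apply, Module.End.mul_apply, jordanL_apply, mul_add, add_mul,
      mul_sub, sub_mul, mul_smul_comm, smul_mul_assoc, mul_assoc, hM, hM', one_mul, mul_one]
    match_scalars <;> field_simp <;> norm_num
  have hMW : jordanL ((3 / 5 : K) • 1 + M) * W = 1 := by
    ext1 X
    simp only [hWX, Module.End.mul_apply, jordanL_apply, mul_add, add_mul, Module.End.one_apply,
      mul_sub, sub_mul, mul_smul_comm, smul_mul_assoc, mul_assoc, hM, hM', one_mul, mul_one]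
    match_scalars <;> field_simp <;> norm_num
  have hNW (X : Matrix (Fin n) (Fin n) K) : (jordanL N * W) X =
      (125 / 96 : K) • ((-8 / 50 : K) • (N * X) + (22 / 50 : K) • (X * N) +
        (4 / 5 : K) • (N * X * M) - (1 / 5 : K) • (M * X * N)) := by
    simp only [hWX, Module.End.mul_apply, jordanL_apply, mul_add, add_mul,
      mul_sub, sub_mul, mul_smul_comm, smul_mul_assoc, mul_assoc, hMN, hNM']
    match_scalars <;> field_simp <;> norm_num
  have hNWNW : (jordanL N * W) * (jordanL N * W) = 1 - sandwich N (25 / 32) := by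
    ext1 X
    rw [Module.End.mul_apply]
    simp only [hNW, LinearMap.sub_apply, Module.End.one_apply, sandwich_apply, mul_add, add_mul,
      mul_sub, sub_mul, mul_smul_comm, smul_mul_assoc, mul_assoc, hMN, hMN', hNM, hNM', hM',
      hN, hN', mul_neg, neg_mul, mul_zero, zero_mul]
    match_scalars <;> field_simp <;> norm_num
  have hadd (A B : Matrix (Fin n) (Fin n) K) : jordanL (A + B) = jordanL A + jordanL B := by
    ext1 X
    simp only [jordanL_apply, LinearMap.add_apply, add_mul, mul_add]
    module
  have hneg : jordanL (-N) * W = -(jordanL N * W) := by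
    ext1 X
    simp only [jordanL_apply, Module.End.mul_apply, LinearMap.neg_apply, neg_mul, mul_neg]
    module
  have : sandwich N (25 / 32) = (jordanL ((3 / 5 : K) • 1 + M + N) * W) *
      (jordanL ((3 / 5 : K) • 1 + M + -N) * W) := by
    rw [hadd _ N, hadd _ (-N), add_mul _ (jordanL N), add_mul _ (jordanL (-N)), hneg, hMW,
      ← sub_eq_add_neg, mul_sub, add_mul, add_mul, hNWNW]
    simp only [one_mul, mul_one]
    abel
  rw [this]
  exact mul_mem (mul_mem (jordanL_mem_JMS _) hWmem) (mul_mem (jordanL_mem_JMS _) hWmem)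

/-- `X ↦ X + c N X N` lies in `JMS` for `N` square-zero and anticommuting with an involution. -/
theorem sandwich_mem_JMS (h2 : (2 : K) ≠ 0) {M N : Matrix (Fin n) (Fin n) K}
    (hM : M * M = 1) (hMN : M * N = N) (hNM : N * M = -N) (hN : N * N = 0) (c : K) :
    sandwich N c ∈ JMS K n := by
  have hpos (t : K) : sandwich N (2⁻¹ * t ^ 2) ∈ JMS K n := by
    obtain ⟨p, hp⟩ := CharP.exists K
    rcases eq_or_ne p 0 with rfl | hp0
    · have : CharZero K := CharP.charP_to_charZero K
      -- `25/32 = (5/4)² / 2`, so the factor `4/5` normalises the coefficient to `t² / 2`.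
      have h := sandwich_mem_JMS_of_charZero (N := (4 / 5 * t) • N) hM (by simp [hMN])
        (by simp [hNM]) (by simp [hN])
      rw [sandwich_smul] at h
      convert h using 2
      ring
    -- In characteristic `p`, adding a coefficient `p - 1` times negates it.
    · have hmul (k : ℕ) : sandwich N (k * (-2⁻¹ * t ^ 2)) ∈ JMS K n := by
        induction k with
        | zero => simpa [sandwich] using one_mem_JMS h2
        | succ k ih =>
          have := mul_mem ih (sandwich_neg_half_mem_JMS h2 hN t)
          rw [sandwich_mul_sandwich hN] at this
          convert this using 2
          push_cast
          ring
      convert hmul (p - 1) using 2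
      rw [Nat.cast_sub (Nat.one_le_iff_ne_zero.2 hp0), CharP.cast_eq_zero]
      push_cast
      ring
  -- Every scalar is a difference of squares: `c = ((c + 1/2)² - (c - 1/2)²) / 2`.
  have := mul_mem (hpos (c + 2⁻¹)) (sandwich_neg_half_mem_JMS h2 hN (c - 2⁻¹))
  rw [sandwich_mul_sandwich hN] at this
  convert this using 2
  field_simp
  ring

/-- `X ↦ (1 + N) X (1 + N)` lies in `JMS` for `N` square-zero, given that `X ↦ X + N X N` does. -/
theorem mulLeft_mul_mulRight_mem_JMS (h2 : (2 : K) ≠ 0) {N : Matrix (Fin n) (Fin n) K}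
    (hN : N * N = 0) (h : sandwich N 1 ∈ JMS K n) :
    LinearMap.mulLeft K (1 + N) * LinearMap.mulRight K (1 + N) ∈ JMS K n := by
  convert mul_mem h (jordanL_mem_JMS (1 + (2 : K) • N)) using 1
  ext1 X
  have hN' (Y : Matrix (Fin n) (Fin n) K) : N * (N * Y) = 0 := by rw [← mul_assoc, hN, zero_mul]
  simp only [Module.End.mul_apply, LinearMap.mulLeft_apply, LinearMap.mulRight_apply,
    sandwich_apply, jordanL_apply, mul_add, add_mul, mul_smul_comm, smul_mul_assoc, mul_assoc,
    hN, hN', mul_zero, zero_mul, one_mul, mul_one]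
  match_scalars <;> field_simp <;> norm_num

end Sandwich

/-! ### Passage to matrices of size `n²`. -/

section Operators

variable {K : Type*} [Field K] {n : ℕ}

open Matrix

/-- This `N` is `e_ij` conjugated by `1 + t e_ji`; the involution `M` is `1 - 2 e_jj` conjugated
likewise. -/
theorem sandwich_corner_mem_JMS (h2 : (2 : K) ≠ 0) {i j : Fin n} (hij : i ≠ j) (t c : K) :
    sandwich (single i j 1 + t • (single j j 1 - single i i 1) - t ^ 2 • single j i 1) c
      ∈ JMS K n := by
  have hM : (1 - (2 : K) • single j j (1 : K) + (2 * t) • single j i 1) *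
      (1 - (2 : K) • single j j (1 : K) + (2 * t) • single j i 1) = 1 := by
    simp only [mul_add, add_mul, mul_sub, sub_mul, smul_mul_assoc, mul_smul_comm,
      single_mul_single_same, single_mul_single_of_ne _ _ _ _ hij, mul_one, one_mul]
    module
  refine sandwich_mem_JMS h2 hM ?_ ?_ ?_ c <;>
  · simp only [mul_add, add_mul, mul_sub, sub_mul, smul_mul_assoc, mul_smul_comm,
      single_mul_single_same, single_mul_single_of_ne _ _ _ _ hij,
      single_mul_single_of_ne _ _ _ _ hij.symm, mul_one, one_mul]
    module

theorem mulLeft_mul_mulRight_single_mem_JMS (h2 : (2 : K) ≠ 0) {i j : Fin n} (hij : i ≠ j)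
    (t : K) : LinearMap.mulLeft K (1 + t • single i j (1 : K)) *
      LinearMap.mulRight K (1 + t • single i j (1 : K)) ∈ JMS K n := by
  apply mulLeft_mul_mulRight_mem_JMS h2
  · simp [single_mul_single_of_ne _ _ _ _ hij.symm]
  · rw [sandwich_smul]
    simpa using sandwich_corner_mem_JMS h2 hij 0 (t ^ 2)

/-- The operator on matrices with the given matrix in the standard basis. -/
noncomputable def opOf : Matrix (Fin n × Fin n) (Fin n × Fin n) K ≃ₐ[K]
    Module.End K (Matrix (Fin n) (Fin n) K) :=
  Matrix.toLinAlgEquiv (Matrix.stdBasis K (Fin n) (Fin n))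

theorem opOf_apply_apply (Q : Matrix (Fin n × Fin n) (Fin n × Fin n) K)
    (X : Matrix (Fin n) (Fin n) K) (i j : Fin n) :
    opOf Q X i j = ∑ b, Q (i, j) b * X b.1 b.2 := by
  have hr (b : Fin n × Fin n) : (Matrix.stdBasis K (Fin n) (Fin n)).repr X b = X b.1 b.2 := by
    simp [stdBasis]
  rw [opOf, Matrix.toLinAlgEquiv_apply, Matrix.sum_apply, Finset.sum_eq_single (i, j)]
  · simp [stdBasis_eq_single, mulVec, dotProduct, hr]
  · rintro ⟨a, b⟩ - hab
    rw [stdBasis_eq_single, Matrix.smul_apply, single_apply_of_ne _ _ _ _ _ (by simpa using hab),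
      smul_zero]
  · simp

theorem opOf_single_apply (a b d e : Fin n) (c : K) (X : Matrix (Fin n) (Fin n) K) :
    opOf (single (a, b) (d, e) c) X = c • (single a d 1 * X * single e b 1) := by
  ext i j
  rw [opOf_apply_apply, Finset.sum_eq_single (d, e)]
  · by_cases hi : a = i
    · by_cases hj : b = j
      · subst hi hj
        simp
      · subst hi
        rw [single_apply_of_ne _ _ _ _ _ (by simp [hj])]
        rw [Matrix.smul_apply, mul_single_apply_of_ne _ _ _ _ _ (Ne.symm hj)]
        simp
    · rw [single_apply_of_ne _ _ _ _ _ (by simp [hi]), mul_assoc, Matrix.smul_apply,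
        single_mul_apply_of_ne _ _ _ _ _ (Ne.symm hi)]
      simp
  · rintro ⟨d', e'⟩ - h
    rw [single_apply_of_ne, zero_mul]
    rintro ⟨-, rfl, rfl⟩
    exact h rfl
  · simp

/-- The matrices in the standard basis of the operators that belong to `JMS K n`. -/
def jmsMatrices (h2 : (2 : K) ≠ 0) : Submonoid (Matrix (Fin n × Fin n) (Fin n × Fin n) K) where
  carrier := {Q | opOf Q ∈ JMS K n}
  mul_mem' ha hb := by simpa using mul_mem ha hb
  one_mem' := by simpa using one_mem_JMS h2

theorem mem_jmsMatrices {h2 : (2 : K) ≠ 0} {Q : Matrix (Fin n × Fin n) (Fin n × Fin n) K} :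
    Q ∈ jmsMatrices h2 ↔ opOf Q ∈ JMS K n := Iff.rfl

/-- With `x = 1 + t e_ji`, `y = x⁻¹` and `N = x e_ij y`, the composite is `X ↦ X + c (x N y) X (y N
x)`. Here `y N x = e_ij`, while `x N y` is `e_ij` conjugated by `1 + q e_ji`, `q = 2t`. -/
theorem rankOne_mem_jmsMatrices (h2 : (2 : K) ≠ 0) {i j : Fin n} (hij : i ≠ j) (q c : K) :
    1 + c • (single (i, j) (j, i) 1 + single (j, j) (j, i) q - single (i, j) (i, i) q
      - single (j, j) (i, i) (q ^ 2)) ∈ jmsMatrices h2 := by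
  obtain ⟨t, rfl⟩ : ∃ t, q = 2 * t := ⟨2⁻¹ * q, by field_simp⟩
  rw [mem_jmsMatrices]
  convert mul_mem (mul_mem (mulLeft_mul_mulRight_single_mem_JMS h2 hij.symm t)
    (sandwich_corner_mem_JMS h2 hij t c))
    (mulLeft_mul_mulRight_single_mem_JMS h2 hij.symm (-t)) using 1
  ext1 X
  set x : Matrix (Fin n) (Fin n) K := 1 + t • single j i 1 with hx
  set y : Matrix (Fin n) (Fin n) K := 1 + -t • single j i 1 with hy
  set N : Matrix (Fin n) (Fin n) K :=
    single i j 1 + t • (single j j 1 - single i i 1) - t ^ 2 • single j i 1 with hN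
  have hxy : x * y = 1 := by
    simp [hx, hy, mul_add, add_mul, single_mul_single_of_ne _ _ _ _ hij]
  have hyx : y * x = 1 := by
    simp [hx, hy, mul_add, add_mul, single_mul_single_of_ne _ _ _ _ hij]
  have h1 : x * N * y = single i j 1 + (2 * t) • (single j j 1 - single i i 1)
      - (2 * t) ^ 2 • single j i 1 := by
    simp only [hx, hy, hN, mul_add, add_mul, mul_sub, sub_mul, smul_mul_assoc, mul_smul_comm,
      single_mul_single_same, single_mul_single_of_ne _ _ _ _ hij, mul_one, one_mul,
      zero_mul]
    module
  have h3 : y * N * x = single i j 1 := by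
    simp only [hx, hy, hN, mul_add, add_mul, mul_sub, sub_mul, smul_mul_assoc, mul_smul_comm,
      single_mul_single_same, single_mul_single_of_ne _ _ _ _ hij, mul_one, one_mul,
      zero_mul]
    module
  clear_value x y N
  have hR : x * (y * X * y + c • (N * (y * X * y) * N)) * x =
      X + c • ((x * N * y) * X * (y * N * x)) := by
    rw [mul_add, add_mul, mul_smul_comm, smul_mul_assoc]
    congr 1
    · rw [show x * (y * X * y) * x = (x * y) * X * (y * x) by simp only [mul_assoc], hxy, hyx,
        one_mul, mul_one]
    · simp only [mul_assoc]
  simp only [Module.End.mul_apply, LinearMap.mulLeft_apply, LinearMap.mulRight_apply,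
    sandwich_apply]
  rw [← mul_assoc, ← mul_assoc y X y, hR, h1, h3]
  simp only [map_add, map_one, map_smul, map_sub, LinearMap.add_apply, LinearMap.sub_apply,
    LinearMap.smul_apply, Module.End.one_apply, opOf_single_apply, add_mul, sub_mul,
    smul_mul_assoc]
  module

/-- Conjugation by transposition sends `L_A` to `L_{Aᵀ}`. -/
theorem submatrix_swap_mem_jmsMatrices {h2 : (2 : K) ≠ 0}
    {Q : Matrix (Fin n × Fin n) (Fin n × Fin n) K} (hQ : Q ∈ jmsMatrices h2) :
    Q.submatrix Prod.swap Prod.swap ∈ jmsMatrices h2 := by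
  let θ : Module.End K (Matrix (Fin n) (Fin n) K) := (transposeLinearEquiv _ _ K K).toLinearMap
  have hθ (X : Matrix (Fin n) (Fin n) K) : θ X = Xᵀ := rfl
  have key : ∀ g ∈ JMS K n, θ * g * θ ∈ JMS K n := by
    intro g hg
    induction hg using Subsemigroup.closure_induction with
    | mem g hg =>
      obtain ⟨A, rfl⟩ := hg
      convert jordanL_mem_JMS Aᵀ using 1
      ext1 X
      simp [hθ, jordanL_apply, add_comm]
    | mul f g _ _ hf hg =>
      convert mul_mem hf hg using 1
      ext1 X
      simp [hθ]
  rw [mem_jmsMatrices] at hQ ⊢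
  convert key _ hQ using 1
  ext X i j
  simp only [Module.End.mul_apply, hθ, transpose_apply, opOf_apply_apply, submatrix_apply,
    Prod.swap_prod_mk]
  exact Fintype.sum_equiv (Equiv.prodComm _ _) _ _ (fun b => by simp)

end Operators

/-! ### Isolating the transvections. -/

section Transvections

variable {K : Type*} [Field K] {n : ℕ}

open Matrix

theorem transvection_mem_trans {ι : Type*} [Fintype ι] [DecidableEq ι]
    (S : Submonoid (Matrix ι ι K)) {a b d : ι} (hab : a ≠ b) (hbd : b ≠ d) (had : a ≠ d)
    (h₁ : ∀ c : K, transvection a b c ∈ S) (h₂ : ∀ c : K, transvection b d c ∈ S) (c : K) :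
    transvection a d c ∈ S := by
  convert mul_mem (mul_mem (h₁ c) (h₂ 1)) (mul_mem (h₁ (-c)) (h₂ (-1))) using 1
  simp only [transvection, mul_add, add_mul, mul_one, one_mul, single_mul_single_same,
    single_mul_single_of_ne _ _ _ _ hab.symm, single_mul_single_of_ne _ _ _ _ hbd.symm,
    single_mul_single_of_ne _ _ _ _ had.symm]
  ext i j
  simp only [Matrix.add_apply, single_apply, Matrix.zero_apply]
  split_ifs <;> ring

theorem transvection_swap_swap_mem_jmsMatrices (h2 : (2 : K) ≠ 0) {i j : Fin n} (hij : i ≠ j)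
    (c : K) : transvection (i, j) (j, i) c ∈ jmsMatrices h2 := by
  simpa [smul_single, transvection] using rankOne_mem_jmsMatrices h2 hij 0 c

/-- Combining `q = 1` with `q = -1` cancels the terms linear in `q`; a known transvection removes
the constant one. -/
theorem transvection_diag_diag_mem_jmsMatrices (h2 : (2 : K) ≠ 0) {i j : Fin n} (hij : i ≠ j)
    (c : K) : transvection (j, j) (i, i) c ∈ jmsMatrices h2 := by
  convert mul_mem (mul_mem (rankOne_mem_jmsMatrices h2 hij 1 (-2⁻¹ * c))
    (rankOne_mem_jmsMatrices h2 hij (-1) (-2⁻¹ * c)))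
    (transvection_swap_swap_mem_jmsMatrices h2 hij c) using 1
  simp only [transvection, smul_add, smul_sub, smul_single, mul_add, add_mul, mul_sub, sub_mul,
    mul_one, one_mul]
  simp [hij, hij.symm, single_mul_single_of_ne]
  ext a b
  simp only [Matrix.add_apply, Matrix.sub_apply, single_apply]
  split_ifs <;> field_simp <;> ring

theorem submatrix_swap_single (a b : Fin n × Fin n) (c : K) :
    (single a b c).submatrix Prod.swap Prod.swap = single a.swap b.swap c :=
  submatrix_single_equiv (Equiv.prodComm _ _) (Equiv.prodComm _ _) _ _ _

theorem submatrix_swap_one :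
    (1 : Matrix (Fin n × Fin n) (Fin n × Fin n) K).submatrix Prod.swap Prod.swap = 1 :=
  submatrix_one_equiv (Equiv.prodComm _ _)

theorem one_add_single_sub_single_mem_jmsMatrices (h2 : (2 : K) ≠ 0) {i j : Fin n} (hij : i ≠ j)
    (c : K) : 1 + single (j, j) (j, i) c - single (i, j) (i, i) c ∈ jmsMatrices h2 := by
  convert mul_mem (mul_mem (rankOne_mem_jmsMatrices h2 hij 1 c)
    (transvection_swap_swap_mem_jmsMatrices h2 hij (-c)))
    (transvection_diag_diag_mem_jmsMatrices h2 hij c) using 1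
  simp only [transvection, smul_add, smul_sub, smul_single, mul_add, add_mul, sub_mul,
    mul_one, one_mul]
  simp [hij, hij.symm, single_mul_single_of_ne]
  ext a b
  simp only [Matrix.add_apply, Matrix.sub_apply, single_apply]
  split_ifs <;> ring

theorem one_add_single_sub_single_mem_jmsMatrices' (h2 : (2 : K) ≠ 0) {i j : Fin n}
    (hij : i ≠ j) (c : K) :
    1 + single (i, i) (j, i) c - single (i, j) (j, j) c ∈ jmsMatrices h2 := by
  simpa [submatrix_add, submatrix_sub, submatrix_swap_single, submatrix_swap_one] using
    submatrix_swap_mem_jmsMatrices (one_add_single_sub_single_mem_jmsMatrices h2 hij.symm c)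

/-- A commutator, with its quadratic term corrected by the last factor. The plus sign, against the
minus sign of the preceding family, lets the two entries be separated. -/
theorem one_add_single_add_single_mem_jmsMatrices (h2 : (2 : K) ≠ 0) {i j : Fin n} (hij : i ≠ j)
    (c : K) : 1 + single (i, i) (j, i) c + single (i, j) (j, j) c ∈ jmsMatrices h2 := by
  convert mul_mem (mul_mem (mul_mem (mul_mem
    (transvection_diag_diag_mem_jmsMatrices h2 hij.symm 1)
    (one_add_single_sub_single_mem_jmsMatrices h2 hij c))
    (transvection_diag_diag_mem_jmsMatrices h2 hij.symm (-1)))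
    (one_add_single_sub_single_mem_jmsMatrices h2 hij (-c)))
    (transvection_swap_swap_mem_jmsMatrices h2 hij (c ^ 2)) using 1
  simp only [transvection, mul_add, add_mul, mul_sub, sub_mul, mul_one, one_mul]
  simp [hij, hij.symm, single_mul_single_of_ne]
  ext a b
  simp only [Matrix.add_apply, Matrix.sub_apply, single_apply]
  split_ifs <;> ring

theorem transvection_diag_left_mem_jmsMatrices (h2 : (2 : K) ≠ 0) {i j : Fin n} (hij : i ≠ j)
    (c : K) : transvection (i, i) (j, i) c ∈ jmsMatrices h2 := by
  convert mul_mem (one_add_single_add_single_mem_jmsMatrices h2 hij (2⁻¹ * c))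
    (one_add_single_sub_single_mem_jmsMatrices' h2 hij (2⁻¹ * c)) using 1
  simp only [transvection, mul_add, add_mul, mul_sub, mul_one, one_mul]
  simp [hij, hij.symm, single_mul_single_of_ne]
  ext a b
  simp only [Matrix.add_apply, Matrix.sub_apply, single_apply]
  split_ifs <;> field_simp <;> ring

theorem transvection_right_diag_mem_jmsMatrices (h2 : (2 : K) ≠ 0) {i j : Fin n} (hij : i ≠ j)
    (c : K) : transvection (i, j) (j, j) c ∈ jmsMatrices h2 := by
  convert mul_mem (one_add_single_add_single_mem_jmsMatrices h2 hij (2⁻¹ * c))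
    (one_add_single_sub_single_mem_jmsMatrices' h2 hij (-(2⁻¹ * c))) using 1
  simp only [transvection, mul_add, add_mul, mul_sub, mul_one, one_mul]
  simp [hij, hij.symm, single_mul_single_of_ne]
  ext a b
  simp only [Matrix.add_apply, Matrix.sub_apply, single_apply]
  split_ifs <;> field_simp <;> ring

/-- All transvections of the space of matrices lie in `JMS`. -/
theorem transvection_mem_jmsMatrices (h2 : (2 : K) ≠ 0) {a b : Fin n × Fin n} (hab : a ≠ b)
    (c : K) : transvection a b c ∈ jmsMatrices h2 := by
  let R (a b : Fin n × Fin n) : Prop := a = b ∨ ∀ c : K, transvection a b c ∈ jmsMatrices h2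
  have trans {a b d} (h₁ : R a b) (h₂ : R b d) : R a d := by
    by_cases had : a = d
    · exact Or.inl had
    by_cases hab : a = b
    · exact hab ▸ h₂
    by_cases hbd : b = d
    · exact hbd ▸ h₁
    exact Or.inr (transvection_mem_trans _ hab hbd had (h₁.resolve_left hab)
      (h₂.resolve_left hbd))
  have hto (i j : Fin n) : R (i, j) (j, j) := by
    by_cases h : i = j
    · exact Or.inl (by rw [h])
    · exact Or.inr (transvection_right_diag_mem_jmsMatrices h2 h)
  have hdiag (i j : Fin n) : R (i, i) (j, j) := by
    by_cases h : i = j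
    · exact Or.inl (by rw [h])
    · exact Or.inr (transvection_diag_diag_mem_jmsMatrices h2 (Ne.symm h))
  have hfrom (i j : Fin n) : R (i, i) (j, i) := by
    by_cases h : i = j
    · exact Or.inl (by rw [h])
    · exact Or.inr (transvection_diag_left_mem_jmsMatrices h2 h)
  -- Any two positions are joined by `(i, j) → (j, j) → (l, l) → (k, l)`.
  exact ((trans (trans (hto a.1 a.2) (hdiag a.2 b.2)) (hfrom b.2 b.1)).resolve_left hab) c

end Transvections

/-! ### Determinants of the operators `L_A`. -/

section Determinants

variable {K : Type*} [Field K] {n : ℕ}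

open Matrix Polynomial

/-- Multiplication by the root in `K[X]/(q)` has characteristic polynomial `q`. -/
theorem exists_charpoly_eq_X_pow_add {r : K[X]} (hr : r.degree < n) :
    ∃ B : Matrix (Fin n) (Fin n) K, B.charpoly = X ^ n + r := by
  have hq : (X ^ n + r).Monic := monic_X_pow_add hr
  have hn : (X ^ n + r).natDegree = n := by
    rw [natDegree_add_eq_left_of_degree_lt (by rwa [degree_X_pow]), natDegree_X_pow]
  generalize X ^ n + r = q at hq hn
  subst hn
  let pb := AdjoinRoot.powerBasis hq.ne_zero
  refine ⟨reindex (finCongr (AdjoinRoot.powerBasis_dim hq.ne_zero))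
    (finCongr (AdjoinRoot.powerBasis_dim hq.ne_zero)) (Algebra.leftMulMatrix pb.basis pb.gen), ?_⟩
  rw [charpoly_reindex, charpoly_leftMulMatrix]
  exact AdjoinRoot.minpoly_powerBasis_gen_of_monic hq

/-- The determinant of `X ↦ -(Cᵀ X + X Cᵀ) / 2` in terms of the characteristic polynomial
of `C`. -/
theorem det_jordanL_neg_transpose (C : Matrix (Fin n) (Fin n) K) :
    (opOf.symm (jordanL (-Cᵀ))).det = 2⁻¹ ^ (n * n) * (aeval (-C) C.charpoly).det := by
  -- The blocks are polynomials in `C`, hence commute, so the determinant can be taken blockwise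
  -- first.
  have h := Matrix.det_det (charmatrix Cᵀ) (aeval (-C) : K[X] →ₐ[K] _).toRingHom
  rw [← Matrix.charpoly, charpoly_transpose] at h
  have key : opOf.symm (jordanL (-Cᵀ)) = (2⁻¹ : K) •
      ((charmatrix Cᵀ).map (aeval (-C) : K[X] →ₐ[K] _).toRingHom).comp _ _ _ _ _ := by
    rw [AlgEquiv.symm_apply_eq]
    ext X i k
    rw [opOf_apply_apply, jordanL_apply, Fintype.sum_prod_type]
    have e (a b : Fin n) : ((2⁻¹ : K) •
        ((charmatrix Cᵀ).map (aeval (-C) : K[X] →ₐ[K] _).toRingHom).comp _ _ _ _ _) (i, k) (a, b)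
        = 2⁻¹ * ((if i = a then -C k b else 0) - (if k = b then C a i else 0)) := by
      simp only [Matrix.smul_apply, comp_apply, map_apply, charmatrix_apply, smul_eq_mul,
        transpose_apply]
      by_cases hia : i = a <;> by_cases hkb : k = b <;>
        simp [hia, hkb, algebraMap_matrix_apply]
    simp only [e, mul_assoc, sub_mul, mul_sub, Finset.sum_sub_distrib, ite_mul, zero_mul,
      mul_ite, mul_zero, Finset.sum_ite_eq, Finset.mem_univ, if_true, Matrix.smul_apply,
      Matrix.add_apply, mul_apply, Matrix.neg_apply, transpose_apply, smul_eq_mul, mul_add,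
      Finset.mul_sum]
    rw [add_comm, sub_eq_add_neg, ← Finset.sum_neg_distrib]
    congr 1
    · rw [Finset.sum_comm' (t' := Finset.univ) (s' := fun _ => Finset.univ) (by simp)]
      simp [mul_comm]
    · simp
  rw [key, det_smul, ← h]
  simp

/-- For `χ = X^n + X + c`, Cayley–Hamilton gives `χ(-C) = χ(-C) - χ(C) = -2C`, and `det C = c`. -/
theorem det_aeval_neg_of_even (hn : 2 ≤ n) (heven : Even n) (c : K) :
    ∃ C : Matrix (Fin n) (Fin n) K, (aeval (-C) C.charpoly).det = (-2) ^ n * c := by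
  have hdeg : (X + Polynomial.C c : K[X]).degree < n := by
    rw [degree_X_add_C]
    exact_mod_cast hn
  obtain ⟨C, hC⟩ := exists_charpoly_eq_X_pow_add hdeg
  have h0 := aeval_self_charpoly C
  have hdet := eval_charpoly C 0
  refine ⟨C, ?_⟩
  rw [hC] at h0 hdet ⊢
  have : aeval (-C) (X ^ n + (X + Polynomial.C c)) = (-2 : K) • C := by
    rw [← sub_zero (aeval (-C) _), ← h0]
    simp only [map_add, map_pow, aeval_X, heven.neg_pow]
    simp
    module
  rw [this, det_smul, Fintype.card_fin]
  simp [det_neg, heven.neg_one_pow, zero_pow (by omega : n ≠ 0)] at hdet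
  rw [← hdet]

theorem det_aeval_neg_of_odd (hn : 2 ≤ n) (hodd : Odd n) {c : K} (hc : c ≠ 0) :
    ∃ C : Matrix (Fin n) (Fin n) K, (aeval (-C) C.charpoly).det = 2 ^ n * c := by
  obtain ⟨k, hk⟩ : ∃ k, n = 2 * k + 3 := by
    obtain ⟨m, rfl⟩ := hodd
    exact ⟨m - 1, by omega⟩
  subst hk
  -- Here `χ(-C) - χ(C) = 2 C^(2k+1) (1 - C²)`. This `d` makes `χ(1) = χ(-1) = c^(-k)`, which
  -- reduces the power of `det C = -c` in the determinant to `c` itself.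
  set d : K := (c ^ k)⁻¹ - c with hd
  let r : K[X] := -X ^ (2 * k + 1) + Polynomial.C d * X ^ 2 + Polynomial.C c
  have hdeg : r.degree < ((2 * k + 3 : ℕ) : WithBot ℕ) := by
    have : r.natDegree ≤ 2 * k + 2 := by
      simp only [r]
      compute_degree
      omega
    refine (degree_le_of_natDegree_le this).trans_lt ?_
    exact_mod_cast Nat.lt_succ_self _
  obtain ⟨C, hC⟩ := exists_charpoly_eq_X_pow_add hdeg
  have h0 := aeval_self_charpoly C
  have hdet0 := eval_charpoly C 0
  have hdet1 := eval_charpoly C 1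
  have hdet2 := eval_charpoly C (-1)
  refine ⟨C, ?_⟩
  have h1 : Odd (2 * k + 1) := odd_two_mul_add_one k
  rw [hC] at h0 hdet0 hdet1 hdet2 ⊢
  have : aeval (-C) (X ^ (2 * k + 3) + r) =
      (2 : K) • (C ^ (2 * k + 1) * (scalar _ 1 - C) * (-(scalar _ (-1) - C))) := by
    rw [← sub_zero (aeval (-C) _), ← h0]
    simp only [r, map_add, map_pow, map_neg, aeval_X, hodd.neg_pow, h1.neg_pow, map_mul]
    simp only [neg_sub, map_one, even_two.neg_pow, aeval_C, sub_neg_eq_add]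
    rw [show ∀ x : Matrix (Fin (2 * k + 3)) (Fin (2 * k + 3)) K, (2 : K) • x = x + x from
      fun x => two_smul K x]
    rw [pow_two C]
    noncomm_ring
  rw [this, det_smul, Fintype.card_fin, det_mul, det_mul, det_neg, det_pow, ← hdet1, ← hdet2]
  simp only [r, map_zero, zero_sub, det_neg, Fintype.card_fin, hodd.neg_one_pow] at hdet0 ⊢
  simp only [eval_add, eval_neg, eval_mul, eval_pow, eval_X, eval_C, hodd.neg_one_pow,
    h1.neg_one_pow, one_pow, hd] at hdet0 ⊢
  simp at hdet0
  rw [show C.det = -c by rw [hdet0, neg_neg], h1.neg_pow]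
  field_simp
  ring

theorem exists_det_jordanL_eq (h2 : (2 : K) ≠ 0) (hn : 2 ≤ n) {e : K} (he : e ≠ 0) :
    ∃ A : Matrix (Fin n) (Fin n) K, (opOf.symm (jordanL A)).det = e := by
  obtain ⟨κ, hκ, H⟩ : ∃ κ : K, κ ≠ 0 ∧ ∀ c : K, c ≠ 0 → ∃ C : Matrix (Fin n) (Fin n) K,
      (aeval (-C) C.charpoly).det = κ * c := by
    rcases Nat.even_or_odd n with h | h
    · exact ⟨(-2) ^ n, pow_ne_zero _ (neg_ne_zero.2 h2), fun c _ => det_aeval_neg_of_even hn h c⟩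
    · exact ⟨2 ^ n, pow_ne_zero _ h2, fun c hc => det_aeval_neg_of_odd hn h hc⟩
  obtain ⟨C, hC⟩ := H (e * (2 ^ (n * n) * κ⁻¹))
    (mul_ne_zero he (mul_ne_zero (pow_ne_zero _ h2) (inv_ne_zero hκ)))
  refine ⟨-Cᵀ, ?_⟩
  rw [det_jordanL_neg_transpose, hC, inv_pow]
  field_simp

end Determinants

/-! ### From transvections and determinants to all operators. -/

section Generation

variable {K : Type*} [Field K] {n : ℕ}

open Matrix

theorem diagonal_two_eq_prod_transvection {ι : Type*} [Fintype ι] [DecidableEq ι] {i j : ι}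
    (hij : i ≠ j) {a : K} (ha : a ≠ 0) :
    transvection i j a * transvection j i (-a⁻¹) * transvection i j a * transvection i j (-1) *
      transvection j i 1 * transvection i j (-1) =
      (diagonal fun k => if k = i then a else if k = j then a⁻¹ else 1) := by
  simp only [transvection, mul_add, add_mul, mul_one, one_mul, single_mul_single_same,
    single_mul_single_of_ne _ _ _ _ hij, single_mul_single_of_ne _ _ _ _ hij.symm, zero_mul]
  ext x y
  simp only [Matrix.add_apply, Matrix.zero_apply, single_apply, diagonal_apply, one_apply]
  by_cases hxi : x = i
  · subst hxi
    by_cases hxy : x = y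
    · subst hxy
      simp [hij.symm, ha]
    · by_cases hjy : j = y
      · subst hjy
        simp [hij, hij.symm, ha]
      · simp [hxy, hjy, hij.symm]
  · by_cases hxj : x = j
    · subst hxj
      by_cases hxy : x = y
      · subst hxy
        simp [hij, hij.symm, ha]
      · by_cases hjy : i = y
        · subst hjy
          simp [hij, hij.symm, ha]
        · simp [hxy, hjy, hij]
    · simp [hxi, hxj, Ne.symm hxi, Ne.symm hxj]

theorem mem_of_det_eq_one_of_transvection_mem {ι : Type*} [Fintype ι] [DecidableEq ι]
    [Nontrivial ι] (S : Submonoid (Matrix ι ι K))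
    (htr : ∀ {i j : ι}, i ≠ j → ∀ c : K, transvection i j c ∈ S)
    {Q : Matrix ι ι K} (hQ : Q.det = 1) : Q ∈ S := by
  suffices h : ∀ g : SpecialLinearGroup ι K, g.1 ∈ S from h ⟨Q, hQ⟩
  intro g
  refine SpecialLinearGroup.diagonal_transvection_induction' (fun g => g.1 ∈ S) g
    (fun i j hij c hc => ?_) (fun i j hij c => htr hij c) (fun A B hA hB => mul_mem hA hB)
  rw [SpecialLinearGroup.diag2n_coe, ← diagonal_two_eq_prod_transvection hij hc]
  exact mul_mem (mul_mem (mul_mem (mul_mem (mul_mem (htr hij _) (htr hij.symm _)) (htr hij _))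
    (htr hij _)) (htr hij.symm _)) (htr hij _)

theorem mem_jmsMatrices_of_det_eq_one (h2 : (2 : K) ≠ 0) (hn : 2 ≤ n)
    {Q : Matrix (Fin n × Fin n) (Fin n × Fin n) K} (hQ : Q.det = 1) : Q ∈ jmsMatrices h2 := by
  have : Nontrivial (Fin n) := Fin.nontrivial_iff_two_le.2 hn
  have : Nonempty (Fin n) := ⟨⟨0, by omega⟩⟩
  exact mem_of_det_eq_one_of_transvection_mem _
    (fun h c => transvection_mem_jmsMatrices h2 h c) hQ

theorem mem_jmsMatrices_of_det_ne_zero (h2 : (2 : K) ≠ 0) (hn : 2 ≤ n)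
    {Q : Matrix (Fin n × Fin n) (Fin n × Fin n) K} (hQ : Q.det ≠ 0) : Q ∈ jmsMatrices h2 := by
  obtain ⟨A, hA⟩ := exists_det_jordanL_eq h2 hn hQ
  set L := opOf.symm (jordanL A) with hL
  have hLmem : L ∈ jmsMatrices h2 := by
    rw [mem_jmsMatrices, hL, AlgEquiv.apply_symm_apply]
    exact jordanL_mem_JMS A
  have hLu : IsUnit L.det := by rw [hA]; exact hQ.isUnit
  have : L⁻¹ * Q ∈ jmsMatrices h2 := by
    apply mem_jmsMatrices_of_det_eq_one h2 hn
    rw [det_mul, det_nonsing_inv, hA, Ring.inverse_eq_inv, inv_mul_cancel₀ hQ]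
  have h := mul_mem hLmem this
  rwa [mul_nonsing_inv_cancel_left _ _ hLu] at h

/-- For diagonal `v`, `L_v` scales `e_ij` by `(v_i + v_j) / 2`. With a single zero entry `v_o` and
the others `1`, only `e_oo` is killed; invertible factors rescale the rest and move the zero to `a`.
-/
theorem diagonal_update_zero_mem_jmsMatrices (h2 : (2 : K) ≠ 0) (hn : 2 ≤ n)
    (a : Fin n × Fin n) : diagonal (Function.update 1 a (0 : K)) ∈ jmsMatrices h2 := by
  let o : Fin n := ⟨0, by omega⟩
  let v : Fin n → K := Function.update 1 o 0
  let w : Fin n × Fin n → K := fun b => 2⁻¹ * (v b.1 + v b.2)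
  have hw : diagonal w ∈ jmsMatrices h2 := by
    rw [mem_jmsMatrices]
    convert jordanL_mem_JMS (diagonal v) using 1
    ext X i j
    rw [opOf_apply_apply, jordanL_apply, Finset.sum_eq_single (i, j)]
    · simp [w]
      ring
    · intro b _ hb
      rw [diagonal_apply_ne' _ hb, zero_mul]
    · simp
  have hv (i : Fin n) (hi : i ≠ o) : v i = 1 := by simp [v, hi]
  have hw0 (b : Fin n × Fin n) (hb : b ≠ (o, o)) : w b ≠ 0 := by
    have ho : v o = 0 := by simp [v]
    obtain ⟨i, j⟩ := b
    by_cases hi : i = o <;> by_cases hj : j = o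
    · exact absurd (by rw [hi, hj]) hb
    · simp [w, hi, hv j hj, ho, h2]
    · simp [w, hj, hv i hi, ho, h2]
    · simp [w, hv i hi, hv j hj, h2, one_add_one_eq_two]
  have hwo : w (o, o) = 0 := by simp [w, v]
  let σ : Equiv.Perm (Fin n × Fin n) := Equiv.swap a (o, o)
  let P : Matrix (Fin n × Fin n) (Fin n × Fin n) K := σ.permMatrix K
  have hP : P.det ≠ 0 := by
    simp only [P, det_permutation]
    rcases Int.units_eq_one_or (Equiv.Perm.sign σ) with h | h <;> simp [h]
  let w' : Fin n × Fin n → K := fun b => if b = (o, o) then 1 else (w b)⁻¹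
  have hw' : (diagonal w').det ≠ 0 := by
    rw [det_diagonal, Finset.prod_ne_zero_iff]
    intro b _
    by_cases hb : b = (o, o)
    · simp [w', hb]
    · simp [w', hb, hw0 b hb]
  convert mul_mem (mul_mem (mem_jmsMatrices_of_det_ne_zero h2 hn hP) (mul_mem hw
    (mem_jmsMatrices_of_det_ne_zero h2 hn hw'))) (mem_jmsMatrices_of_det_ne_zero h2 hn hP) using 1
  have hww' : (fun b => w b * w' b) =
      Function.update (1 : Fin n × Fin n → K) (o, o) 0 := by
    ext b
    by_cases hb : b = (o, o)
    · subst hb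
      simp [hwo]
    · simp [w', hb, hw0 b hb]
  rw [diagonal_mul_diagonal, hww']
  simp only [P, Equiv.Perm.permMatrix, PEquiv.toMatrix_toPEquiv_mul, PEquiv.mul_toMatrix_toPEquiv]
  ext x y
  simp only [submatrix_apply, id, diagonal_apply, σ, Equiv.symm_swap]
  by_cases hxy : x = y
  · subst hxy
    by_cases hx : x = a
    · subst hx
      simp
    · have : Equiv.swap a (o, o) x ≠ (o, o) := by
        rw [Ne, Equiv.swap_apply_eq_iff, Equiv.swap_apply_right]
        exact hx
      simp [hx, this]
  · simp [hxy]

theorem jmsMatrices_eq_top (h2 : (2 : K) ≠ 0) (hn : 2 ≤ n) : jmsMatrices (n := n) h2 = ⊤ := by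
  refine eq_top_iff.2 fun Q _ => ?_
  refine diagonal_transvection_induction (· ∈ jmsMatrices h2) Q (fun D _ => ?_)
    (fun t => transvection_mem_jmsMatrices h2 t.hij t.c) (fun A B hA hB => mul_mem hA hB)
  have hupd (a : Fin n × Fin n) (c : K) :
      diagonal (Function.update 1 a c) ∈ jmsMatrices h2 := by
    rcases eq_or_ne c 0 with rfl | hc
    · exact diagonal_update_zero_mem_jmsMatrices h2 hn a
    · apply mem_jmsMatrices_of_det_ne_zero h2 hn
      rw [det_diagonal, Finset.prod_update_of_mem (Finset.mem_univ a)]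
      simpa using hc
  have hpart (s : Finset (Fin n × Fin n)) :
      diagonal (fun a => if a ∈ s then D a else 1) ∈ jmsMatrices h2 := by
    induction s using Finset.induction_on with
    | empty => simp
    | insert b s hb ih =>
      convert mul_mem (hupd b (D b)) ih using 1
      rw [diagonal_mul_diagonal]
      congr 1
      ext a
      by_cases hab : a = b
      · subst hab
        simp [hb]
      · simp [hab]
  simpa using hpart Finset.univ

theorem JMS_eq_top (h2 : (2 : K) ≠ 0) (hn : 2 ≤ n) : JMS K n = ⊤ := by
  refine eq_top_iff.2 fun g _ => ?_
  have : opOf.symm g ∈ jmsMatrices h2 := jmsMatrices_eq_top (n := n) h2 hn ▸ Submonoid.mem_top _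
  rwa [mem_jmsMatrices, AlgEquiv.apply_symm_apply] at this

end Generation

theorem corollary4p9 {K : Type*} [Field K] (n : ℕ) (hn : 2 ≤ n) :
    (Infinite K → ringChar K ≠ 2 →
      (∀ g : LinearMap.GeneralLinearGroup K (Matrix (Fin n) (Fin n) K),
        (g : Module.End K (Matrix (Fin n) (Fin n) K)) ∈ JMS K n) ∧
      JMS K n = ⊤) ∧
    (Finite K → Odd (ringChar K) →
      (∀ g : LinearMap.GeneralLinearGroup K (Matrix (Fin n) (Fin n) K),
        (g : Module.End K (Matrix (Fin n) (Fin n) K)) ∈ JMS K n) ∧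
      JMS K n = ⊤) := by
  have key (h : ringChar K ≠ 2) :
      (∀ g : LinearMap.GeneralLinearGroup K (Matrix (Fin n) (Fin n) K),
        (g : Module.End K (Matrix (Fin n) (Fin n) K)) ∈ JMS K n) ∧ JMS K n = ⊤ := by
    have htop : JMS K n = ⊤ := JMS_eq_top (Ring.two_ne_zero h) hn
    exact ⟨fun g => htop ▸ Subsemigroup.mem_top _, htop⟩
  refine ⟨fun _ h => key h, fun _ h => key ?_⟩
  rintro h'
  rw [h'] at h
  exact absurd h (by decide)
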